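/- **Setting.** Let $m,m',n,a,b\ge 0$ be integers and write $[k]=\{1,\dots,k\}$. A linear code $\mathcal C$ of $m\times n$ matrices over a field $\mathbb F$ *instantiates the topology* $T_{m,n}(a,b,0)$ if there are matrices $H_{\mathrm{row}}\in\mathbb F^{b\times n}$ and $H_{\mathrm{col}}\in\mathbb F^{a\times m}$ (whose rows need not be linearly independent) such that $\mathcal C$ is the set of all $C\in\mathbb F^{m\times n}$ every row $r$ of which satisfies $H_{\mathrm{row}}\,r^{t}=0$ and every column $c$ of which satisfies $H_{\mathrm{col}}\,c=0$. An erasure pattern $E\subseteq[m]\times[n]$ is *recoverable* for $T_{m,n}(a,b,0)$ if, over some finite field, there is a code $\mathcal C$ instantiating $T_{m,n}(a,b,0)$ with $\dim(\mathcal C|_{D\setminus E})=\dim(\mathcal C)$, where $D=[m]\times[n]$ and $\mathcal C|_{D\setminus E}$ is the restriction of $\mathcal C$ to the coordinates outside $E$. The pattern $E$ is *row-wise irreducible* (for $b$) if every row that contains an erasure contains at least $b+1$ erasures. It is *regular* for $T_{m,n}(a,b,0)$ if for all $U\subseteq[m]$ and $V\subseteq[n]$ $$|E\cap(U\times V)|\le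 |U||V|-\max(|U|-a,0)\,\max(|V|-b,0).$$ For $E\subseteq[m]\times[n]$ let $V_i=\{j:(i,j)\in E\}$. A pattern $E'\subseteq[m+m']\times[n]$ with rows $V'_i=\{j:(i,j)\in E'\}$ is an *extension* of $E$ if $V'_i=V_i$ for $i\in[m]$ and there is an injective map $f:[m']\to[m]$ with $V'_{m+\ell}=V_{f(\ell)}$ for all $\ell\in[m']$ (some rows of $E$ are replicated, each at most once). **Theorem.** Let $E\subseteq[m]\times[n]$ be row-wise irreducible (for $b$) and regular for $T_{m,n}(1,b,0)$, and let $E'\subseteq[m+m']\times[n]$ be an extension of $E$. Then $E'$ is recoverable for the topology $T_{m+m',n}(2,b,0)$. -/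

import Mathlib

namespace GridTopology

/-- The `F`-linear code `C` of `m × n` matrices instantiates the topology `T_{m,n}(a, b, h)`:
for some parity-check matrices (whose rows need not be linearly independent), `C` is the set of
*all* matrices each of whose rows satisfies the `b` row parities, each of whose columns satisfies
the `a` column parities, and whose vectorization satisfies the `h` global parities.
For `h = 0` these are exactly the product codes of a column code and a row code. -/
def Instantiates {F : Type*} [Field F] {m n : ℕ} (a b h : ℕ)
    (C : Submodule F (Matrix (Fin m) (Fin n) F)) : Prop :=
  ∃ (Hrow : Matrix (Fin b) (Fin n) F) (Hcol : Matrix (Fin a) (Fin m) F)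
    (Hglob : Matrix (Fin h) (Fin m × Fin n) F),
    ∀ c : Matrix (Fin m) (Fin n) F, c ∈ C ↔
      (∀ i : Fin m, Hrow.mulVec (fun j => c i j) = 0) ∧
      (∀ j : Fin n, Hcol.mulVec (fun i => c i j) = 0) ∧
      Hglob.mulVec (fun p => c p.1 p.2) = 0

/-- The restriction of a matrix to the coordinates outside `E`. -/
def restrictCompl (F : Type*) [Field F] {m n : ℕ} (E : Finset (Fin m × Fin n)) :
    Matrix (Fin m) (Fin n) F →ₗ[F] ({p : Fin m × Fin n // p ∉ E} → F) where
  toFun c p := c p.1.1 p.1.2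
  map_add' _ _ := rfl
  map_smul' _ _ := rfl

/-- The code `C|_{D \ E}`: the code `C` punctured to the coordinates outside `E`. -/
def puncture {F : Type*} [Field F] {m n : ℕ} (C : Submodule F (Matrix (Fin m) (Fin n) F))
    (E : Finset (Fin m × Fin n)) : Submodule F ({p : Fin m × Fin n // p ∉ E} → F) :=
  C.map (restrictCompl F E)

/-- `E` is a recoverable erasure pattern for the topology `T_{m,n}(a, b, h)`: over some finite
field there is a code `C` instantiating the topology with `dim C|_{D \ E} = dim C`. -/
def Recoverable {m n : ℕ} (a b h : ℕ) (E : Finset (Fin m × Fin n)) : Prop :=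
  ∃ (F : Type) (_ : Field F) (_ : Finite F) (C : Submodule F (Matrix (Fin m) (Fin n) F)),
    Instantiates a b h C ∧ Module.finrank F (puncture C E) = Module.finrank F C

/-- The set `V_i` of columns erased in row `i`. -/
def erasedCols {m n : ℕ} (E : Finset (Fin m × Fin n)) (i : Fin m) : Finset (Fin n) :=
  Finset.univ.filter (fun j => (i, j) ∈ E)

/-- Row-wise irreducibility: each row with an erasure has at least `b + 1` erasures. -/
def RowIrreducible {m n : ℕ} (b : ℕ) (E : Finset (Fin m × Fin n)) : Prop :=
  ∀ i : Fin m, (erasedCols E i).Nonempty → b + 1 ≤ (erasedCols E i).card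

/-- Regularity for the topology `T_{m,n}(a, b, 0)`. -/
def Regular {m n : ℕ} (a b : ℕ) (E : Finset (Fin m × Fin n)) : Prop :=
  ∀ (U : Finset (Fin m)) (V : Finset (Fin n)),
    ((E ∩ U ×ˢ V).card : ℤ) ≤
      (U.card : ℤ) * V.card - max ((U.card : ℤ) - a) 0 * max ((V.card : ℤ) - b) 0

/-- `E'` arises from `E` by appending `m'` rows, each a replica of a row of `E`, where each row
of `E` is replicated at most once (so that its replication factor is at most two). -/
def IsExtension {m m' n : ℕ} (E : Finset (Fin m × Fin n))
    (E' : Finset (Fin (m + m') × Fin n)) : Prop :=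
  (∀ i : Fin m, erasedCols E' (Fin.castAdd m' i) = erasedCols E i) ∧
  ∃ f : Fin m' → Fin m, Function.Injective f ∧
    ∀ l : Fin m', erasedCols E' (Fin.natAdd m l) = erasedCols E (f l)

end GridTopology

/-!
A pattern is recoverable as soon as, for some parity checks, the only codeword supported on it is
zero (`recoverable_of_parityChecks`). The two column parities are chosen as "the original rows sum
to zero" and "the replicas sum to zero". Since the replicas come from distinct rows of `E`, each of
the two conditions on its own is an instance of the same problem: a family of words `c i` of the row
code, with `c i` supported in the column set `V i` of row `i` of `E`, which sums to zero. It
therefore suffices to find a single row code `C` of length `n` for which the subspaces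
`C ∩ F^{V i}` are independent (`exists_parityCheck_independent`).

For nonempty sets `U` of nonempty rows, regularity with `a = 1` says
`∑ i ∈ U, (#(V i) - b) + b ≤ #(⋃ i ∈ U, V i)` (`sum_card_erasedCols_le`). Take a generic matrix `M`
with `n - b` rows, of which `#(V i) - b` are supported in `V i`, for each `i`, and the remaining
ones are unrestricted. The inequality is what Hall's theorem needs to produce a nonzero monomial in
every maximal minor of `M`, so that all these minors are nonzero polynomials; they are specialized
to nonzero integers and then reduced modulo a large prime
(`exists_prime_matrix_minors_ne_zero`). The row space `C` of `M` is then an MDS code, so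
`C ∩ F^{V i}` has dimension at most `#(V i) - b` and is spanned by the rows of `M` in block `i`
(`vecMul_eq_zero_off_of_support`). As the rows of `M` are linearly independent, so are these
subspaces.
-/

namespace GridTopology

open Finset

/-! ### Generic matrices with prescribed supports -/

/-- Every maximal minor of the generic matrix with row supports `S r` is a nonzero polynomial: a
Hall matching of the rows to the columns of the minor gives a monomial of coefficient `±1`. Integer
values at which none of these polynomials vanishes give the matrix. -/
theorem exists_int_matrix_minors_ne_zero {R α : Type*} [Fintype R] [DecidableEq R] [Fintype α]
    [DecidableEq α] (b : ℕ) (S : R → Finset α) (hcard : Fintype.card R + b = Fintype.card α)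
    (hS : ∀ s : Finset R, s.Nonempty → #s + b ≤ #(s.biUnion S)) :
    ∃ M : Matrix R α ℤ, (∀ r j, j ∉ S r → M r j = 0) ∧
      ∀ e : R ↪ α, (M.submatrix id e).det ≠ 0 := by
  classical
  let P : Matrix R α (MvPolynomial (R × α) ℤ) := Matrix.of fun r j =>
    if j ∈ S r then MvPolynomial.X (r, j) else 0
  have hP : ∀ e : R ↪ α, (P.submatrix id e).det ≠ 0 := by
    intro e
    obtain ⟨f, hf, hfS⟩ := (Finset.all_card_le_biUnion_card_iff_exists_injective
      (fun r => univ.filter fun r' => e r' ∈ S r)).1 (by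
        intro s
        rcases s.eq_empty_or_nonempty with rfl | hs
        · simp
        have h1 : (s.biUnion S ∩ univ.map e) =
            (s.biUnion fun r => univ.filter fun r' => e r' ∈ S r).map e := by
          ext j
          simp only [mem_inter, mem_biUnion, mem_map, mem_univ, true_and, mem_filter]
          constructor
          · rintro ⟨⟨r, hr, hj⟩, r', rfl⟩
            exact ⟨r', ⟨r, hr, hj⟩, rfl⟩
          · rintro ⟨r', ⟨r, hr, hj⟩, rfl⟩
            exact ⟨⟨r, hr, hj⟩, r', rfl⟩
        have h2 := card_union_add_card_inter (s.biUnion S) (univ.map e)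
        rw [h1, card_map, card_map, card_univ] at h2
        have h3 := card_le_univ (s.biUnion S ∪ univ.map e)
        have h4 := hS s hs
        omega)
    let σ : Equiv.Perm R := Equiv.ofBijective f (Finite.injective_iff_bijective.1 hf)
    intro h0
    -- Substituting the indicator of the matching turns the minor into a permutation matrix.
    have h := congrArg (MvPolynomial.eval fun q : R × α => if e (f q.1) = q.2 then (1 : ℤ) else 0) h0
    rw [RingHom.map_det, map_zero] at h
    have hmat : (MvPolynomial.eval fun q : R × α =>
        if e (f q.1) = q.2 then (1 : ℤ) else 0).mapMatrix (P.submatrix id e) =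
        (σ.toPEquiv.toMatrix : Matrix R R ℤ) := by
      ext r r'
      have := hfS r
      simp only [mem_filter, mem_univ, true_and] at this
      by_cases hr : f r = r'
      · subst hr
        simp [P, σ, PEquiv.toMatrix_apply, this]
      · have : e r' ∈ S r → ¬ (e (f r) = e r') := fun _ h => hr (e.injective h)
        by_cases hh : e r' ∈ S r <;> simp [P, σ, PEquiv.toMatrix_apply, hh, hr]
    rw [hmat, Matrix.det_permutation] at h
    exact (Units.ne_zero _) (by exact_mod_cast h)
  have hprod : (∏ e : R ↪ α, (P.submatrix id e).det) ≠ 0 := prod_ne_zero_iff.2 fun e _ => hP e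
  obtain ⟨x, hx⟩ : ∃ x, MvPolynomial.eval x (∏ e : R ↪ α, (P.submatrix id e).det) ≠ 0 := by
    by_contra! h
    exact hprod (MvPolynomial.funext fun x => by rw [h x, map_zero])
  rw [map_prod, prod_ne_zero_iff] at hx
  refine ⟨P.map (MvPolynomial.eval x), fun r j hj => by simp [P, hj], fun e => ?_⟩
  have := hx e (mem_univ e)
  rwa [RingHom.map_det] at this

/-- The integer matrix of `exists_int_matrix_minors_ne_zero`, modulo a prime exceeding the product
of its minors. -/
theorem exists_prime_matrix_minors_ne_zero {R α : Type*} [Fintype R] [DecidableEq R] [Fintype α]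
    [DecidableEq α] (b : ℕ) (S : R → Finset α) (hcard : Fintype.card R + b = Fintype.card α)
    (hS : ∀ s : Finset R, s.Nonempty → #s + b ≤ #(s.biUnion S)) :
    ∃ p : ℕ, p.Prime ∧ ∃ M : Matrix R α (ZMod p), (∀ r j, j ∉ S r → M r j = 0) ∧
      ∀ e : R ↪ α, (M.submatrix id e).det ≠ 0 := by
  classical
  obtain ⟨M, hM, hdet⟩ := exists_int_matrix_minors_ne_zero b S hcard hS
  obtain ⟨p, hp, hprime⟩ :=
    Nat.exists_infinite_primes ((∏ e : R ↪ α, (M.submatrix id e).det).natAbs + 1)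
  refine ⟨p, hprime, M.map (Int.castRingHom (ZMod p)), fun r j hj => by simp [hM r j hj],
    fun e h => ?_⟩
  have h1 : ((M.submatrix id e).det : ZMod p) = 0 := by
    rw [← eq_intCast (Int.castRingHom (ZMod p)), RingHom.map_det]
    exact h
  rw [ZMod.intCast_zmod_eq_zero_iff_dvd] at h1
  have h2 := h1.trans (dvd_prod_of_mem (fun e : R ↪ α => (M.submatrix id e).det) (mem_univ e))
  have h3 := Int.natAbs_dvd_natAbs.2 h2
  rw [Int.natAbs_natCast] at h3
  have := Nat.le_of_dvd (Int.natAbs_pos.2 (prod_ne_zero_iff.2 fun e _ => hdet e)) h3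
  omega

/-! ### Row spaces of matrices with nonzero maximal minors -/

section MDS

variable {R α F : Type*} [Fintype R] [Field F]

/-- The row space is an MDS code: a word vanishing on as many coordinates as `M` has rows is zero. -/
theorem vecMul_eq_zero_of_card_le [DecidableEq R] {M : Matrix R α F}
    (hM : ∀ e : R ↪ α, (M.submatrix id e).det ≠ 0) {y : R → F} {K : Finset α}
    (hK : Fintype.card R ≤ #K) (hy : ∀ j ∈ K, Matrix.vecMul y M j = 0) : y = 0 := by
  classical
  obtain ⟨e⟩ : Nonempty (R ↪ K) :=
    Function.Embedding.nonempty_of_card_le (by simpa using hK)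
  refine Matrix.eq_zero_of_vecMul_eq_zero (hM (e.trans (Function.Embedding.subtype _))) ?_
  ext r
  exact hy (e r) (e r).2

/-- The row space of a full-rank matrix is the kernel of a parity-check matrix. -/
theorem exists_parityCheck {b n : ℕ} {M : Matrix R (Fin n) F}
    (hcard : Fintype.card R + b = n)
    (hM : Function.Injective fun y => Matrix.vecMul y M) :
    ∃ H : Matrix (Fin b) (Fin n) F, ∀ x, H.mulVec x = 0 ↔ ∃ y, Matrix.vecMul y M = x := by
  classical
  let C : Submodule F (Fin n → F) := LinearMap.range M.vecMulLinear
  have hC : Module.finrank F C = Fintype.card R := by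
    rw [LinearMap.finrank_range_of_inj hM, Module.finrank_fintype_fun_eq_card]
  have hQ : Module.finrank F ((Fin n → F) ⧸ C) = Module.finrank F (Fin b → F) := by
    have := C.finrank_quotient_add_finrank
    simp only [Module.finrank_fintype_fun_eq_card, Fintype.card_fin] at this ⊢
    omega
  let φ : ((Fin n → F) ⧸ C) ≃ₗ[F] (Fin b → F) := LinearEquiv.ofFinrankEq _ _ hQ
  refine ⟨LinearMap.toMatrix' (φ.toLinearMap ∘ₗ C.mkQ), fun x => ?_⟩
  rw [LinearMap.toMatrix'_mulVec]
  simp [C]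

/-- Let every maximal minor of `M` be nonzero. If `#V - b` rows of `M` are supported in `V`, then
they span all vectors of the row space supported in `V`. This is stated on coefficient vectors: by
the MDS property, that space has dimension `#V - b`, which the given rows already attain. -/
theorem vecMul_eq_zero_off_of_support [DecidableEq R] [Fintype α] [DecidableEq α] {M : Matrix R α F} {b : ℕ}
    (hcard : Fintype.card R + b = Fintype.card α)
    (hM : ∀ e : R ↪ α, (M.submatrix id e).det ≠ 0) {V : Finset α} {T : Finset R}
    (hT : #T + b = #V) (hTV : ∀ r ∈ T, ∀ j ∉ V, M r j = 0) {y : R → F}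
    (hy : ∀ j ∉ V, Matrix.vecMul y M j = 0) : ∀ r ∉ T, y r = 0 := by
  classical
  obtain ⟨B, hBV, hB⟩ := exists_subset_card_eq (show b ≤ #V by omega)
  have hBc : Fintype.card R ≤ #Bᶜ := by rw [card_compl]; omega
  -- A combination of the rows in `T` agrees with `y M` on `V \ B`. Both vanish off `V`, so their
  -- difference lives on the `b` coordinates in `B` and is zero by the MDS property.
  let ext : (T → F) → R → F := fun z r => if h : r ∈ T then z ⟨r, h⟩ else 0
  have hext (z : T → F) (j : α) :
      Matrix.vecMul (ext z) M j = ∑ r : T, z r * M r j := by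
    rw [Matrix.vecMul, dotProduct, ← sum_subset (subset_univ T), ← sum_coe_sort T]
    · refine sum_congr rfl fun r _ => ?_
      simp [ext]
    · intro r _ hr
      simp [ext, hr]
  have hextV (z : T → F) (j : α) (hj : j ∉ V) : Matrix.vecMul (ext z) M j = 0 := by
    rw [hext]
    exact sum_eq_zero fun r _ => by rw [hTV r r.2 j hj, mul_zero]
  let L : (T → F) →ₗ[F] (↥(V \ B) → F) :=
    (M.submatrix (Subtype.val : T → R) (Subtype.val : ↥(V \ B) → α)).vecMulLinear
  have hL (z : T → F) (j : ↥(V \ B)) : L z j = Matrix.vecMul (ext z) M j := by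
    rw [hext]; rfl
  have hinj : Function.Injective L := by
    rw [← LinearMap.ker_eq_bot, LinearMap.ker_eq_bot']
    intro z hz
    have : ext z = 0 := vecMul_eq_zero_of_card_le hM hBc fun j hj => by
      by_cases hjV : j ∈ V
      · rw [← hL z ⟨j, mem_sdiff.2 ⟨hjV, mem_compl.1 hj⟩⟩, hz]; rfl
      · exact hextV z j hjV
    ext r
    simpa [ext] using congrFun this r
  have hdim : Module.finrank F (T → F) = Module.finrank F (↥(V \ B) → F) := by
    simp only [Module.finrank_fintype_fun_eq_card, Fintype.card_coe, card_sdiff_of_subset hBV]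
    omega
  obtain ⟨z, hz⟩ := (LinearMap.injective_iff_surjective_of_finrank_eq_finrank hdim).1 hinj
    fun j => Matrix.vecMul y M j
  have hyz : y - ext z = 0 := vecMul_eq_zero_of_card_le hM hBc fun j hj => by
    rw [Matrix.sub_vecMul, Pi.sub_apply, sub_eq_zero]
    by_cases hjV : j ∈ V
    · rw [← hL z ⟨j, mem_sdiff.2 ⟨hjV, mem_compl.1 hj⟩⟩, hz]
    · rw [hextV z j hjV, hy j hjV]
  intro r hr
  rw [sub_eq_zero.1 hyz]
  simp [ext, hr]

end MDS

/-- There is a row code, given by its parity-check matrix `H`, whose subspaces of words supported in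
`V i` are independent as `i` varies. -/
theorem exists_parityCheck_independent {ι : Type*} [Fintype ι] [DecidableEq ι] {n b : ℕ}
    (hbn : b ≤ n)
    (V : ι → Finset (Fin n)) (hirr : ∀ i, (V i).Nonempty → b + 1 ≤ #(V i))
    (hreg : ∀ U : Finset ι, U.Nonempty → (∀ i ∈ U, (V i).Nonempty) →
      ∑ i ∈ U, (#(V i) - b) + b ≤ #(U.biUnion V)) :
    ∃ p : ℕ, p.Prime ∧ ∃ H : Matrix (Fin b) (Fin n) (ZMod p), ∀ c : ι → Fin n → ZMod p,
      (∀ i, H.mulVec (c i) = 0) → (∀ i, ∀ j ∉ V i, c i j = 0) → ∑ i, c i = 0 → c = 0 := by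
  classical
  -- Each `i` contributes a block of `#(V i) - b` rows supported in `V i`; rows of full support
  -- bring the total to `n - b`.
  let B := Σ i, Fin (#(V i) - b)
  have hB : Fintype.card B = ∑ i, (#(V i) - b) := by simp [B, Fintype.card_sigma]
  have hBn : Fintype.card B + b ≤ n := by
    rw [hB, ← sum_filter_of_ne (p := fun i => (V i).Nonempty)]
    · rcases (univ.filter fun i => (V i).Nonempty).eq_empty_or_nonempty with h | h
      · rw [h]; simpa using hbn
      · refine (hreg _ h fun i hi => (mem_filter.1 hi).2).trans ?_
        simpa using card_le_univ ((univ.filter fun i => (V i).Nonempty).biUnion V)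
    · intro i _ hi
      rw [nonempty_iff_ne_empty]
      intro h
      simp [h] at hi
  let R := B ⊕ Fin (n - b - Fintype.card B)
  have hR : Fintype.card R + b = Fintype.card (Fin n) := by
    simp only [R, Fintype.card_sum, Fintype.card_fin]
    omega
  let S : R → Finset (Fin n) := Sum.elim (fun q => V q.1) fun _ => univ
  have hS : ∀ s : Finset R, s.Nonempty → #s + b ≤ #(s.biUnion S) := by
    intro s hs
    by_cases hr : ∃ t, Sum.inr t ∈ s
    · obtain ⟨t, ht⟩ := hr
      have h1 : #(univ : Finset (Fin n)) ≤ #(s.biUnion S) :=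
        card_le_card (subset_biUnion_of_mem S ht)
      have h2 := card_le_univ s
      rw [card_univ] at h1
      omega
    -- If `s` has no row of full support, then it lies in the blocks indexed by some set `U`.
    · let U : Finset ι := univ.filter fun i => ∃ t, (Sum.inl ⟨i, t⟩ : R) ∈ s
      have hsU : s ⊆ (U.sigma fun _ => univ).map
          (Function.Embedding.inl : B ↪ R) := by
        rintro (⟨i, t⟩ | t) h
        · refine mem_map.2 ⟨⟨i, t⟩, ?_, rfl⟩
          exact mem_sigma.2 ⟨mem_filter.2 ⟨mem_univ _, t, h⟩, mem_univ _⟩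
        · exact (hr ⟨t, h⟩).elim
      have h1 := card_le_card hsU
      rw [card_map, card_sigma] at h1
      simp only [card_univ, Fintype.card_fin] at h1
      have hU : ∀ i ∈ U, (V i).Nonempty := by
        intro i hi
        obtain ⟨t, -⟩ := (mem_filter.1 hi).2
        exact card_pos.1 (by have := t.2; omega)
      have hUne : U.Nonempty := by
        obtain ⟨⟨i, t⟩ | t, h⟩ := hs
        · exact ⟨i, mem_filter.2 ⟨mem_univ _, t, h⟩⟩
        · exact (hr ⟨t, h⟩).elim
      have h2 : U.biUnion V ⊆ s.biUnion S := by
        refine biUnion_subset.2 fun i hi => ?_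
        obtain ⟨t, ht⟩ := (mem_filter.1 hi).2
        exact subset_biUnion_of_mem S ht
      have h3 := hreg U hUne hU
      have h4 := card_le_card h2
      omega
  obtain ⟨p, hp, M, hMS, hM⟩ := exists_prime_matrix_minors_ne_zero b S hR hS
  have := Fact.mk hp
  have hRn : Fintype.card R ≤ #(univ : Finset (Fin n)) := by rw [card_univ]; omega
  have hMinj : ∀ y, Matrix.vecMul y M = 0 → y = 0 := fun y hy =>
    vecMul_eq_zero_of_card_le hM hRn fun j _ => congrFun hy j
  obtain ⟨H, hH⟩ := exists_parityCheck (b := b) (M := M) (by simpa using hR) (by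
    intro y y' h
    refine sub_eq_zero.1 (hMinj _ ?_)
    rw [Matrix.sub_vecMul, sub_eq_zero]
    exact h)
  refine ⟨p, hp, H, fun c hc hcV hsum => ?_⟩
  choose y hy using fun i => (hH (c i)).1 (hc i)
  -- The word `c i` is a combination of the rows of block `i` alone.
  have hblock : ∀ i r, (∀ t, r ≠ Sum.inl ⟨i, t⟩) → y i r = 0 := by
    intro i r hr
    rcases (V i).eq_empty_or_nonempty with h | h
    · rw [hMinj (y i) (by
        rw [hy i]
        ext j
        exact hcV i j (by simp [h]))]
      rfl
    · refine vecMul_eq_zero_off_of_support hR hM (V := V i)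
        (T := univ.filter fun r => ∃ t, r = Sum.inl ⟨i, t⟩) ?_ ?_ ?_ r ?_
      · have : (univ.filter fun r : R => ∃ t, r = Sum.inl ⟨i, t⟩) =
            univ.image fun t => (Sum.inl ⟨i, t⟩ : R) := by
          ext r
          simp [eq_comm]
        rw [this, card_image_of_injective, card_univ, Fintype.card_fin]
        · have := hirr i h
          omega
        · intro t t' htt
          simpa [R, B] using Sum.inl_injective htt
      · intro r hr j hj
        obtain ⟨t, rfl⟩ := (mem_filter.1 hr).2
        exact hMS _ j hj
      · intro j hj
        rw [hy i]
        exact hcV i j hj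
      · simpa using hr
  have hysum : ∑ i, y i = 0 := by
    refine hMinj _ ?_
    rw [← hsum, ← sum_congr rfl fun i _ => hy i]
    exact map_sum M.vecMulLinear y univ
  have hyz : ∀ i, y i = 0 := by
    intro i
    ext r
    by_cases hr : ∃ t, r = Sum.inl ⟨i, t⟩
    · obtain ⟨t, rfl⟩ := hr
      have h := congrFun hysum (Sum.inl ⟨i, t⟩)
      rw [Finset.sum_apply, sum_eq_single i] at h
      · exact h
      · intro i' _ hi'
        refine hblock i' _ fun t' h => hi' ?_
        have := congrArg Sigma.fst (Sum.inl_injective h)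
        exact this.symm
      · simp
    · exact hblock i r fun t h => hr ⟨t, h⟩
  ext1 i
  rw [← hy i, hyz i, Matrix.zero_vecMul]
  rfl

/-! ### Recoverability and regularity -/

/-- A pattern is recoverable if, for some choice of parity checks, no nonzero codeword is supported
on it. -/
theorem recoverable_of_parityChecks {F : Type} [Field F] [Finite F] {m n a b : ℕ}
    {E : Finset (Fin m × Fin n)} (Hrow : Matrix (Fin b) (Fin n) F)
    (Hcol : Matrix (Fin a) (Fin m) F)
    (h : ∀ c : Matrix (Fin m) (Fin n) F, (∀ i, Hrow.mulVec (c i) = 0) →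
      (∀ j, Hcol.mulVec (fun i => c i j) = 0) → (∀ i j, (i, j) ∉ E → c i j = 0) → c = 0) :
    Recoverable a b 0 E := by
  let C : Submodule F (Matrix (Fin m) (Fin n) F) :=
    { carrier := {c | (∀ i, Hrow.mulVec (c i) = 0) ∧ ∀ j, Hcol.mulVec (fun i => c i j) = 0}
      zero_mem' := ⟨fun i => Matrix.mulVec_zero _, fun j => Matrix.mulVec_zero _⟩
      add_mem' := fun {x y} hx hy => ⟨fun i => by
          have := Matrix.mulVec_add Hrow (x i) (y i)
          rw [hx.1, hy.1, add_zero] at this; exact this, fun j => by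
          have := Matrix.mulVec_add Hcol (fun i => x i j) (fun i => y i j)
          rw [hx.2, hy.2, add_zero] at this; exact this⟩
      smul_mem' := fun t x hx => ⟨fun i => by
          have := Matrix.mulVec_smul Hrow t (x i)
          rw [hx.1, smul_zero] at this; exact this, fun j => by
          have := Matrix.mulVec_smul Hcol t (fun i => x i j)
          rw [hx.2, smul_zero] at this; exact this⟩ }
  refine ⟨F, inferInstance, inferInstance, C, ⟨Hrow, Hcol, 0, fun c => ?_⟩, ?_⟩
  · refine ⟨fun hc => ⟨hc.1, hc.2, Subsingleton.elim _ _⟩, fun hc => ⟨hc.1, hc.2.1⟩⟩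
  · rw [puncture, ← LinearMap.range_domRestrict]
    refine LinearMap.finrank_range_of_inj (LinearMap.ker_eq_bot.1 (LinearMap.ker_eq_bot'.2 ?_))
    rintro ⟨c, hc⟩ h0
    exact Subtype.ext (h c hc.1 hc.2 fun i j hij => congrFun h0 ⟨(i, j), hij⟩)

theorem card_inter_product_biUnion_erasedCols {m n : ℕ} (E : Finset (Fin m × Fin n)) (U : Finset (Fin m)) :
    #(E ∩ U ×ˢ U.biUnion (erasedCols E)) = ∑ i ∈ U, #(erasedCols E i) := by
  rw [← card_sigma]
  refine card_nbij' (fun q => ⟨q.1, q.2⟩) (fun q => (q.1, q.2)) ?_ ?_ ?_ ?_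
  · rintro ⟨i, j⟩ h
    simp_all [erasedCols]
  · rintro ⟨i, j⟩ h
    simp_all [erasedCols]
    exact ⟨i, h⟩
  · intro _ _; rfl
  · intro _ _; rfl

/-- Regularity for `a = 1`, tested on nonempty rows `U` and the union of their column sets. Row-wise
irreducibility makes the truncated differences `#(erasedCols E i) - b` genuine. -/
theorem sum_card_erasedCols_le {m n b : ℕ} {E : Finset (Fin m × Fin n)}
    (hirr : RowIrreducible b E) (hreg : Regular 1 b E) {U : Finset (Fin m)} (hU : U.Nonempty)
    (hne : ∀ i ∈ U, (erasedCols E i).Nonempty) :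
    ∑ i ∈ U, (#(erasedCols E i) - b) + b ≤ #(U.biUnion (erasedCols E)) := by
  have h := hreg U (U.biUnion (erasedCols E))
  rw [card_inter_product_biUnion_erasedCols] at h
  obtain ⟨i₀, hi₀⟩ := hU
  have hV : b + 1 ≤ #(U.biUnion (erasedCols E)) :=
    (hirr i₀ (hne i₀ hi₀)).trans (card_le_card (subset_biUnion_of_mem _ hi₀))
  have hU1 : 1 ≤ #U := card_pos.2 ⟨i₀, hi₀⟩
  have hsum : ∑ i ∈ U, (#(erasedCols E i) - b) + #U * b = ∑ i ∈ U, #(erasedCols E i) := by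
    rw [← smul_eq_mul, ← sum_const, ← sum_add_distrib]
    refine sum_congr rfl fun i hi => ?_
    have := hirr i (hne i hi)
    omega
  rw [← hsum, max_eq_left (by push_cast; omega), max_eq_left (by omega)] at h
  push_cast at h
  have : ((∑ i ∈ U, (#(erasedCols E i) - b) : ℕ) : ℤ) + b ≤ #(U.biUnion (erasedCols E)) := by
    push_cast
    linarith
  exact_mod_cast this

end GridTopology

open GridTopology Finset in
theorem mainTheorem2 (m m' n b : ℕ) (E : Finset (Fin m × Fin n))
    (hirr : GridTopology.RowIrreducible b E) (hreg : GridTopology.Regular 1 b E)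
    (E' : Finset (Fin (m + m') × Fin n)) (hext : GridTopology.IsExtension E E') :
    GridTopology.Recoverable 2 b 0 E' := by
  obtain ⟨hE, f, hf, hE'⟩ := hext
  have hE₀ : ∀ i j, (i, j) ∉ E' ↔ j ∉ erasedCols E' i := by simp [erasedCols]
  by_cases hbn : b ≤ n
  swap
  · -- Rows shorter than `b` cannot hold `b + 1` erasures, so nothing is erased.
    have hempty : ∀ i, erasedCols E i = ∅ := by
      intro i
      by_contra h
      have h1 := hirr i (nonempty_iff_ne_empty.2 h)
      have h2 := card_le_univ (erasedCols E i)
      rw [Fintype.card_fin] at h2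
      omega
    refine recoverable_of_parityChecks (F := ZMod 2) 0 0 fun c _ _ hc => ?_
    ext i j
    refine hc i j ((hE₀ i j).2 ?_)
    induction i using Fin.addCases with
    | left i => simp [hE, hempty]
    | right l => simp [hE', hempty]
  obtain ⟨p, hp, H, hH⟩ := exists_parityCheck_independent hbn (erasedCols E) hirr
    fun U hU hne => sum_card_erasedCols_le hirr hreg hU hne
  have := Fact.mk hp
  -- One column parity sums the original rows, the other sums the replicas.
  refine recoverable_of_parityChecks (F := ZMod p) H
    (Matrix.of ![Fin.addCases (fun _ => 1) fun _ => 0, Fin.addCases (fun _ => 0) fun _ => 1])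
    fun c hrow hcol hc => ?_
  have h0 : ∀ j, ∑ i, c (Fin.castAdd m' i) j = 0 := fun j => by
    simpa [Matrix.mulVec, dotProduct, Fin.sum_univ_add] using congrFun (hcol j) 0
  have h1 : ∀ j, ∑ l, c (Fin.natAdd m l) j = 0 := fun j => by
    simpa [Matrix.mulVec, dotProduct, Fin.sum_univ_add] using congrFun (hcol j) 1
  have hc0 := hH (fun i => c (Fin.castAdd m' i)) (fun i => hrow _)
    (fun i j hj => hc _ _ ((hE₀ _ _).2 (by rwa [hE])))
    (by ext j; rw [Finset.sum_apply]; exact h0 j)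
  -- The replicas, moved back along `f` to the rows they copy and padded with zero rows.
  have hc1 := hH (Function.extend f (fun l => c (Fin.natAdd m l)) 0)
    (fun i => by
      by_cases hi : ∃ l, f l = i
      · obtain ⟨l, rfl⟩ := hi
        rw [hf.extend_apply]
        exact hrow _
      · rw [Function.extend_apply' _ _ _ hi]
        exact Matrix.mulVec_zero _)
    (fun i j hj => by
      by_cases hi : ∃ l, f l = i
      · obtain ⟨l, rfl⟩ := hi
        rw [hf.extend_apply]
        exact hc _ _ ((hE₀ _ _).2 (by rwa [hE']))
      · rw [Function.extend_apply' _ _ _ hi]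
        rfl)
    (by
      rw [← Fintype.sum_of_injective f hf (fun l => c (Fin.natAdd m l))]
      · ext j
        rw [Finset.sum_apply]
        exact h1 j
      · intro i hi
        rw [Function.extend_apply' _ _ _ hi]
        rfl
      · intro l
        rw [hf.extend_apply])
  ext i j
  induction i using Fin.addCases with
  | left i => exact congrFun (congrFun hc0 i) j
  | right l =>
    have := congrFun hc1 (f l)
    rw [hf.extend_apply] at this
    exact congrFun this j
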